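/- For $n\in\mathbb N$ let $C_m^{(n)}(\sigma)$ be the number of cycles of length $m$ of a permutation $\sigma\in S_n$ (fixed points are cycles of length $1$), where $\sigma$ is chosen uniformly at random from $S_n$. Let $\mathrm{Log}$ be the principal branch of the logarithm, and for $x,s\in\mathbb C$ with $|x|<1$ put $$Z_n^s(x)=\prod_{m=1}^n(1-x^m)^{sC_m^{(n)}},$$ where the powers are principal powers $(1-x^m)^{w}=\exp(w\,\mathrm{Log}(1-x^m))$. Let $Y_1,Y_2,\dots$ be independent random variables, $Y_m$ being Poisson distributed with mean $1/m$, and put $$Z_\infty^s(x)=\prod_{m=1}^\infty(1-x^m)^{sY_m}.$$ **Lemma.** For all fixed $x,s\in\mathbb C$ with $|x|<1$, the series $\sum_{m\ge1}Y_m\,\mathrm{Log}(1-x^m)$ is almost surely absolutely convergent, the infinite product $Z_\infty^s(x)$ is almost surely (unconditionally) convergent, and, as $n\to\infty$, $$s\sum_{m=1}^n C_m^{(n)}\,\mathrm{Log}(1-x^m)\ \xrightarrow{d}\ s\sum_{m=1}^\infty Y_m\,\mathrm{Log}(1-x^m),\qquad Z_n^s(x)\ \xrightarrow{d}\ Z_\infty^s(x).$$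 -/

import Mathlib

open Filter MeasureTheory ProbabilityTheory
open scoped NNReal

noncomputable section

/-- Every subset of the symmetric group `S_n` is an event. -/
instance permMeasurableSpace (n : ℕ) : MeasurableSpace (Equiv.Perm (Fin n)) := ⊤

/-- The uniform probability measure on the symmetric group `S_n`. -/
def uniformPerm (n : ℕ) : Measure (Equiv.Perm (Fin n)) :=
  (PMF.uniformOfFintype (Equiv.Perm (Fin n))).toMeasure

instance uniformPerm_isProbabilityMeasure (n : ℕ) : IsProbabilityMeasure (uniformPerm n) :=
  inferInstanceAs (IsProbabilityMeasure (PMF.uniformOfFintype (Equiv.Perm (Fin n))).toMeasure)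

/-- The number of cycles of length `m` of `σ`, where the fixed points of `σ` are its cycles of
length one. -/
def cycleCount {n : ℕ} (m : ℕ) (σ : Equiv.Perm (Fin n)) : ℕ :=
  σ.partition.parts.count m

/-- The logarithm `s ∑_{m = 1}^n C_m Log (1 - x ^ m)` of `Z_n^s(x)`, as a function on `S_n`. -/
def logZ (n : ℕ) (s x : ℂ) (σ : Equiv.Perm (Fin n)) : ℂ :=
  s * ∑ m ∈ Finset.Icc 1 n, (cycleCount m σ : ℂ) * Complex.log (1 - x ^ m)

/-- `Z_n^s(x) = ∏_{m = 1}^n (1 - x ^ m) ^ (s C_m)`, as a function on `S_n`; the powers are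
principal ones. -/
def charZ (n : ℕ) (s x : ℂ) (σ : Equiv.Perm (Fin n)) : ℂ :=
  ∏ m ∈ Finset.Icc 1 n, (1 - x ^ m) ^ (s * (cycleCount m σ : ℂ))

/-- `s ∑_{m = 1}^∞ y_m Log (1 - x ^ m)`. -/
def logZInf (s x : ℂ) (y : ℕ+ → ℕ) : ℂ :=
  s * ∑' m : ℕ+, (y m : ℂ) * Complex.log (1 - x ^ (m : ℕ))

/-- `∏_{m = 1}^∞ (1 - x ^ m) ^ (s y_m)`; with independent Poisson variables of mean `1 / m` in the
place of `y_m` this is `Z_∞^s(x)`. -/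
def charZInf (s x : ℂ) (y : ℕ+ → ℕ) : ℂ :=
  ∏' m : ℕ+, (1 - x ^ (m : ℕ)) ^ (s * (y m : ℂ))

end

/-!
Give weight `w m` to each cycle of length `m`. At `t`, the characteristic function of the sum of the
weights over the cycles of a uniform permutation in `S_n` is the cycle index `h_n` evaluated at
`z m = exp (i ⟪w m, t⟫)`, and `∑ₙ h_n(z) X ^ n = exp (∑ₘ z m / m * X ^ m)`. Writing
`z m = 1 + (z m - 1)` splits off the factor `exp (∑ₘ X ^ m / m) = 1 / (1 - X)`, so `h_n(z)` is the
`n`-th partial sum of the coefficients of `exp (∑ₘ (z m - 1) / m * X ^ m)`. These coefficients are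
absolutely summable, hence `h_n(z)` tends to `exp (∑ₘ (z m - 1) / m)`, the characteristic function
of the compound Poisson sum `∑ₘ Y m • w m`, and Lévy's continuity theorem applies. The lemma is the
case `w m = s Log (1 - x ^ m)`, followed by exponentiation.
-/

open PowerSeries
open scoped Nat

section Partition

theorem toFinset_parts_subset_Icc {n : ℕ} (p : n.Partition) :
    p.parts.toFinset ⊆ Finset.Icc 1 n := fun m hm ↦ by
  rw [Multiset.mem_toFinset] at hm
  exact Finset.mem_Icc.2 ⟨p.parts_pos hm, p.le_of_mem_parts hm⟩

theorem sum_count_mul_eq {n : ℕ} (p : n.Partition) :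
    ∑ m ∈ Finset.Icc 1 n, p.parts.count m * m = n := by
  simpa only [smul_eq_mul, p.parts_sum] using
    (Finset.sum_multiset_count_of_subset _ _ (toFinset_parts_subset_Icc p)).symm

end Partition

section CentralizerOrder

/-- The order of the centralizer of a permutation whose cycle lengths, fixed points included,
form the multiset `s`. -/
def centralizerOrder (s : Multiset ℕ) : ℕ :=
  s.prod * ∏ i ∈ s.toFinset, (s.count i)!

theorem centralizerOrder_eq_of_subset {s : Multiset ℕ} {t : Finset ℕ} (h : s.toFinset ⊆ t) :
    centralizerOrder s = s.prod * ∏ i ∈ t, (s.count i)! := by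
  rw [centralizerOrder, Finset.prod_subset h]
  intro i _ hi
  rw [Multiset.count_eq_zero_of_notMem (mt Multiset.mem_toFinset.2 hi), Nat.factorial_zero]

theorem centralizerOrder_cons (m : ℕ) (s : Multiset ℕ) :
    centralizerOrder (m ::ₘ s) = m * (s.count m + 1) * centralizerOrder s := by
  have hm : m ∈ insert m s.toFinset := Finset.mem_insert_self _ _
  have hcount : ∏ i ∈ (insert m s.toFinset).erase m, ((m ::ₘ s).count i)!
      = ∏ i ∈ (insert m s.toFinset).erase m, (s.count i)! :=
    Finset.prod_congr rfl fun i hi ↦ by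
      rw [Multiset.count_cons_of_ne (Finset.ne_of_mem_erase hi)]
  rw [centralizerOrder, Multiset.toFinset_cons,
    centralizerOrder_eq_of_subset (Finset.subset_insert m s.toFinset),
    ← Finset.mul_prod_erase _ _ hm, ← Finset.mul_prod_erase _ _ hm, hcount, Multiset.prod_cons,
    Multiset.count_cons_self, Nat.factorial_succ]
  ring

theorem centralizerOrder_add_replicate_one {s : Multiset ℕ} (hs : 1 ∉ s) (k : ℕ) :
    centralizerOrder (s + Multiset.replicate k 1) = k ! * centralizerOrder s := by
  induction k with
  | zero => simp
  | succ k ih =>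
    rw [Multiset.replicate_succ, Multiset.add_cons, centralizerOrder_cons, ih, Multiset.count_add,
      Multiset.count_eq_zero_of_notMem hs, Multiset.count_replicate_self, Nat.factorial_succ]
    ring

theorem centralizerOrder_pos {n : ℕ} (p : n.Partition) : 0 < centralizerOrder p.parts :=
  Nat.mul_pos (Multiset.prod_pos fun _ ha ↦ p.parts_pos ha)
    (Finset.prod_pos fun _ _ ↦ Nat.factorial_pos _)

theorem parts_eq_filter_two_le_add_replicate {n : ℕ} (p : n.Partition) :
    p.parts = p.parts.filter (2 ≤ ·) + Multiset.replicate (p.parts.count 1) 1 := by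
  have hone : p.parts.filter (¬ 2 ≤ ·) = p.parts.filter (· = 1) :=
    Multiset.filter_congr fun i hi ↦ by
      have := p.parts_pos hi
      omega
  rw [← Multiset.filter_eq', ← hone, Multiset.filter_add_not]

theorem sum_filter_two_le_add_count_one {n : ℕ} (p : n.Partition) :
    (p.parts.filter (2 ≤ ·)).sum + p.parts.count 1 = n := by
  have h := congrArg Multiset.sum (parts_eq_filter_two_le_add_replicate p)
  rwa [p.parts_sum, Multiset.sum_add, Multiset.sum_replicate, smul_eq_mul, mul_one, eq_comm] at h

end CentralizerOrder

section PermPartition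

variable {α : Type*} [Fintype α] [DecidableEq α]

theorem partition_eq_iff_cycleType_eq (σ : Equiv.Perm α) (p : (Fintype.card α).Partition) :
    σ.partition = p ↔ σ.cycleType = p.parts.filter (2 ≤ ·) := by
  constructor
  · rintro rfl
    exact Equiv.Perm.filter_parts_partition_eq_cycleType.symm
  · intro h
    have hfixed : Fintype.card α - σ.support.card = p.parts.count 1 := by
      rw [← Equiv.Perm.sum_cycleType, h]
      have := sum_filter_two_le_add_count_one p
      omega
    rw [Nat.Partition.ext_iff, Equiv.Perm.parts_partition, h, hfixed,
      ← parts_eq_filter_two_le_add_replicate]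

theorem card_partition_eq_mul_centralizerOrder (p : (Fintype.card α).Partition) :
    (Finset.univ.filter fun σ : Equiv.Perm α ↦ σ.partition = p).card * centralizerOrder p.parts
      = (Fintype.card α)! := by
  set c := p.parts.filter (2 ≤ ·) with hc
  have hc2 : ∀ a ∈ c, 2 ≤ a := fun a ha ↦ (Multiset.mem_filter.1 ha).2
  have hsum : c.sum + p.parts.count 1 = Fintype.card α := sum_filter_two_le_add_count_one p
  have horder : centralizerOrder p.parts
      = (Fintype.card α - c.sum)! * c.prod * ∏ i ∈ c.toFinset, (c.count i)! := by
    rw [parts_eq_filter_two_le_add_replicate p, ← hc,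
      centralizerOrder_add_replicate_one fun h ↦ absurd (hc2 1 h) (by decide), centralizerOrder,
      Nat.sub_eq_of_eq_add' hsum.symm, mul_assoc]
  simp_rw [partition_eq_iff_cycleType_eq, ← hc]
  rw [horder, Equiv.Perm.card_of_cycleType_mul_eq, if_pos ⟨by omega, hc2⟩]

end PermPartition

section CycleIndex

variable {K : Type*} [Field K] [CharZero K]

/-- The cycle index of the symmetric group `S_n`, evaluated at the variables `z 1, z 2, …`: the mean
over `S_n` of the product of `z m` over the cycle lengths `m`, fixed points included. -/
def symmCycleIndex (z : ℕ → K) (n : ℕ) : K :=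
  (∑ σ : Equiv.Perm (Fin n), (σ.partition.parts.map z).prod) / n !

theorem sum_perm_partition {α : Type*} [Fintype α] [DecidableEq α] {n : ℕ}
    (hn : Fintype.card α = n) (F : Multiset ℕ → K) :
    ∑ σ : Equiv.Perm α, F σ.partition.parts
      = n ! * ∑ p : n.Partition, F p.parts / centralizerOrder p.parts := by
  subst hn
  rw [← Finset.sum_fiberwise Finset.univ fun σ : Equiv.Perm α ↦ σ.partition, Finset.mul_sum]
  refine Finset.sum_congr rfl fun p _ ↦ ?_
  have hp : (centralizerOrder p.parts : K) ≠ 0 := Nat.cast_ne_zero.2 (centralizerOrder_pos p).ne'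
  have hclass : ∀ σ ∈ Finset.univ.filter fun σ : Equiv.Perm α ↦ σ.partition = p,
      F σ.partition.parts = F p.parts := fun σ hσ ↦ by rw [(Finset.mem_filter.1 hσ).2]
  rw [Finset.sum_congr rfl hclass, Finset.sum_const, nsmul_eq_mul,
    ← card_partition_eq_mul_centralizerOrder p, Nat.cast_mul]
  field_simp

theorem symmCycleIndex_eq_sum_partition (z : ℕ → K) (n : ℕ) :
    symmCycleIndex z n = ∑ p : n.Partition, (p.parts.map z).prod / centralizerOrder p.parts := by
  rw [symmCycleIndex, sum_perm_partition (Fintype.card_fin n) fun s ↦ (s.map z).prod,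
    mul_div_cancel_left₀ _ (Nat.cast_ne_zero.2 n.factorial_ne_zero)]

theorem symmCycleIndex_zero (z : ℕ → K) : symmCycleIndex z 0 = 1 := by
  simp [symmCycleIndex_eq_sum_partition, centralizerOrder]

theorem symmCycleIndex_one (n : ℕ) : symmCycleIndex (1 : ℕ → K) n = 1 := by
  simp [symmCycleIndex, Fintype.card_perm, n.factorial_ne_zero]

theorem sum_partition_count_mul_div_centralizerOrder {m n : ℕ} (hm : 1 ≤ m) (hmn : m ≤ n)
    (F : Multiset ℕ → K) :
    ∑ p : n.Partition, (p.parts.count m * m : K) * (F p.parts / centralizerOrder p.parts)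
      = ∑ q : (n - m).Partition, F (m ::ₘ q.parts) / centralizerOrder q.parts := by
  have hmem : ∀ p ∈ (Finset.univ : Finset n.Partition),
      (p.parts.count m * m : K) * (F p.parts / centralizerOrder p.parts) ≠ 0 → m ∈ p.parts :=
    fun p _ h ↦ by
      contrapose! h
      rw [Multiset.count_eq_zero_of_notMem h, Nat.cast_zero, zero_mul, zero_mul]
  rw [← Finset.sum_filter_of_ne hmem,
    Finset.sum_subtype (p := fun p : n.Partition ↦ m ∈ p.parts) _ (by simp),
    ← (Nat.Partition.partitionWithPartEquiv hm hmn).symm.sum_comp]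
  refine Finset.sum_congr rfl fun q _ ↦ ?_
  have hq : (centralizerOrder q.parts : K) ≠ 0 := Nat.cast_ne_zero.2 (centralizerOrder_pos q).ne'
  have hm0 : (m : K) ≠ 0 := Nat.cast_ne_zero.2 (by omega)
  have hcount : (q.parts.count m + 1 : K) ≠ 0 := Nat.cast_add_one_ne_zero _
  rw [Nat.Partition.partitionWithPartEquiv_symm_apply_parts, centralizerOrder_cons,
    Multiset.count_cons_self]
  push_cast
  field_simp

theorem mul_symmCycleIndex (z : ℕ → K) (n : ℕ) :
    n * symmCycleIndex z n = ∑ m ∈ Finset.Icc 1 n, z m * symmCycleIndex z (n - m) := by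
  have hn (p : n.Partition) : (n : K) = ∑ m ∈ Finset.Icc 1 n, (p.parts.count m * m : K) := by
    exact_mod_cast (sum_count_mul_eq p).symm
  calc n * symmCycleIndex z n
      = ∑ p : n.Partition, ∑ m ∈ Finset.Icc 1 n,
          (p.parts.count m * m : K) * ((p.parts.map z).prod / centralizerOrder p.parts) := by
        simp_rw [symmCycleIndex_eq_sum_partition, Finset.mul_sum, ← Finset.sum_mul, ← hn]
    _ = ∑ m ∈ Finset.Icc 1 n, ∑ p : n.Partition,
          (p.parts.count m * m : K) * ((p.parts.map z).prod / centralizerOrder p.parts) :=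
        Finset.sum_comm
    _ = ∑ m ∈ Finset.Icc 1 n, z m * symmCycleIndex z (n - m) := by
        refine Finset.sum_congr rfl fun m hm ↦ ?_
        obtain ⟨hm1, hmn⟩ := Finset.mem_Icc.1 hm
        rw [sum_partition_count_mul_div_centralizerOrder hm1 hmn fun s ↦ (s.map z).prod,
          symmCycleIndex_eq_sum_partition, Finset.mul_sum]
        simp_rw [Multiset.map_cons, Multiset.prod_cons, mul_div_assoc]

/-- The ordinary generating series `∑ₙ h_n X ^ n` of the cycle indices of the symmetric groups. -/
def symmCycleIndexSeries (z : ℕ → K) : K⟦X⟧ :=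
  mk (symmCycleIndex z)

theorem constantCoeff_symmCycleIndexSeries (z : ℕ → K) :
    constantCoeff (symmCycleIndexSeries z) = 1 := by
  rw [← coeff_zero_eq_constantCoeff_apply, symmCycleIndexSeries, coeff_mk, symmCycleIndex_zero]

theorem derivative_symmCycleIndexSeries (z : ℕ → K) :
    d⁄dX K (symmCycleIndexSeries z) = mk (fun i ↦ z (i + 1)) * symmCycleIndexSeries z := by
  ext n
  have hrec := mul_symmCycleIndex z (n + 1)
  rw [← Finset.Ico_add_one_right_eq_Icc, Finset.sum_Ico_eq_sum_range, Nat.cast_add_one,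
    Nat.add_sub_cancel] at hrec
  rw [coeff_derivative, coeff_mul, Finset.Nat.sum_antidiagonal_eq_sum_range_succ_mk,
    symmCycleIndexSeries, coeff_mk, mul_comm, hrec]
  refine Finset.sum_congr rfl fun i _ ↦ ?_
  rw [coeff_mk, coeff_mk, add_comm 1 i, Nat.add_sub_add_right]

theorem eq_of_derivative_eq_mul {R : Type*} [CommRing R] [IsAddTorsionFree R] {Q F G : R⟦X⟧}
    (hF : d⁄dX R F = Q * F) (hG : d⁄dX R G = Q * G)
    (h : constantCoeff F = constantCoeff G) : F = G := by
  ext n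
  induction n using Nat.strong_induction_on with
  | _ n ih =>
    cases n with
    | zero => simpa using h
    | succ n =>
      have hcoeff : coeff n (d⁄dX R F) = coeff n (d⁄dX R G) := by
        rw [hF, hG, coeff_mul, coeff_mul]
        exact Finset.sum_congr rfl fun ij hij ↦ by
          rw [ih ij.2 (Finset.Nat.antidiagonal.snd_lt hij)]
      simp only [coeff_derivative, mul_comm _ ((n : R) + 1)] at hcoeff
      exact mod_cast nsmul_right_injective n.succ_ne_zero (by simpa [nsmul_eq_mul] using hcoeff)

theorem symmCycleIndexSeries_add (u v : ℕ → K) :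
    symmCycleIndexSeries (u + v) = symmCycleIndexSeries u * symmCycleIndexSeries v := by
  refine eq_of_derivative_eq_mul (derivative_symmCycleIndexSeries _) ?_ ?_
  · have hadd : (mk fun i ↦ (u + v) (i + 1) : K⟦X⟧)
        = mk (fun i ↦ u (i + 1)) + mk (fun i ↦ v (i + 1)) := rfl
    rw [Derivation.leibniz, derivative_symmCycleIndexSeries, derivative_symmCycleIndexSeries, hadd]
    simp only [smul_eq_mul]
    ring
  · simp only [map_mul, constantCoeff_symmCycleIndexSeries, mul_one]

end CycleIndex

section SymmCycleIndexExp

variable {K : Type*} [Field K]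

/-- The exponent `∑_{m ≥ 1} v m / m * X ^ m` of the exponential formula for the cycle indices; its
constant coefficient `v 0 / 0` is `0`. -/
def cycleExponent (v : ℕ → K) : K⟦X⟧ :=
  mk fun m ↦ v m / m

theorem constantCoeff_cycleExponent (v : ℕ → K) : constantCoeff (cycleExponent v) = 0 := by
  rw [← coeff_zero_eq_constantCoeff_apply, cycleExponent, coeff_mk, Nat.cast_zero, div_zero]

variable [CharZero K]

theorem derivative_cycleExponent (v : ℕ → K) :
    d⁄dX K (cycleExponent v) = mk fun i ↦ v (i + 1) := by
  ext i
  rw [coeff_derivative, cycleExponent, coeff_mk, coeff_mk, Nat.cast_add_one,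
    div_mul_cancel₀ _ (Nat.cast_add_one_ne_zero i)]

theorem symmCycleIndexSeries_eq_exp_subst [Algebra ℚ K] (v : ℕ → K) :
    symmCycleIndexSeries v = (exp K).subst (cycleExponent v) := by
  have hsubst : HasSubst (cycleExponent v) :=
    .of_constantCoeff_zero' (constantCoeff_cycleExponent v)
  refine eq_of_derivative_eq_mul (derivative_symmCycleIndexSeries v) ?_ ?_
  · rw [derivative_subst hsubst, derivative_exp, derivative_cycleExponent, mul_comm]
  · have hpow (k : ℕ) (hk : k ≠ 0) : coeff k (exp K) • coeff 0 (cycleExponent v ^ k) = 0 := by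
      rw [coeff_zero_eq_constantCoeff_apply, map_pow, constantCoeff_cycleExponent, zero_pow hk,
        smul_zero]
    rw [constantCoeff_symmCycleIndexSeries, ← coeff_zero_eq_constantCoeff_apply,
      coeff_subst' hsubst, finsum_eq_single _ 0 hpow]
    simp

theorem symmCycleIndex_one_add (v : ℕ → K) (n : ℕ) :
    symmCycleIndex (1 + v) n = ∑ j ∈ Finset.range (n + 1), symmCycleIndex v j := by
  have h := congrArg (coeff n) (symmCycleIndexSeries_add v 1)
  rw [coeff_mul, Finset.Nat.sum_antidiagonal_eq_sum_range_succ_mk, add_comm v 1] at h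
  simpa only [symmCycleIndexSeries, coeff_mk, symmCycleIndex_one, mul_one] using h

end SymmCycleIndexExp

section CoeffSum

variable {R : Type*} [NormedCommRing R] {F G A : R⟦X⟧}

theorem summable_norm_coeff_mul (hF : Summable fun n ↦ ‖coeff n F‖)
    (hG : Summable fun n ↦ ‖coeff n G‖) : Summable fun n ↦ ‖coeff n (F * G)‖ := by
  simp_rw [coeff_mul]
  exact summable_norm_sum_mul_antidiagonal_of_summable_norm
    (f := fun n ↦ coeff n F) (g := fun n ↦ coeff n G) hF hG

theorem tsum_norm_coeff_mul_le (hF : Summable fun n ↦ ‖coeff n F‖)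
    (hG : Summable fun n ↦ ‖coeff n G‖) :
    ∑' n, ‖coeff n (F * G)‖ ≤ (∑' n, ‖coeff n F‖) * ∑' n, ‖coeff n G‖ := by
  have hprod : Summable fun kl : ℕ × ℕ ↦ ‖coeff kl.1 F‖ * ‖coeff kl.2 G‖ :=
    hF.mul_of_nonneg hG (fun _ ↦ norm_nonneg _) fun _ ↦ norm_nonneg _
  rw [hF.tsum_mul_tsum_eq_tsum_sum_antidiagonal hG hprod]
  refine (summable_norm_coeff_mul hF hG).tsum_le_tsum (fun n ↦ ?_)
    (summable_sum_mul_antidiagonal_of_summable_mul (f := fun n ↦ ‖coeff n F‖)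
      (g := fun n ↦ ‖coeff n G‖) hprod)
  rw [coeff_mul]
  exact (norm_sum_le _ _).trans (Finset.sum_le_sum fun _ _ ↦ norm_mul_le _ _)

theorem summable_norm_coeff_pow (hA : Summable fun n ↦ ‖coeff n A‖) (k : ℕ) :
    Summable fun n ↦ ‖coeff n (A ^ k)‖ := by
  induction k with
  | zero => exact summable_of_ne_finset_zero (s := {0}) (by simp +contextual [coeff_one])
  | succ k ih => exact pow_succ A k ▸ summable_norm_coeff_mul ih hA

theorem tsum_norm_coeff_pow_le [NormOneClass R] (hA : Summable fun n ↦ ‖coeff n A‖) (k : ℕ) :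
    ∑' n, ‖coeff n (A ^ k)‖ ≤ (∑' n, ‖coeff n A‖) ^ k := by
  induction k with
  | zero => simp [coeff_one, apply_ite norm]
  | succ k ih =>
    rw [pow_succ, pow_succ]
    refine (tsum_norm_coeff_mul_le (summable_norm_coeff_pow hA k) hA).trans ?_
    gcongr

theorem tsum_coeff_pow [CompleteSpace R] (hA : Summable fun n ↦ ‖coeff n A‖) (k : ℕ) :
    ∑' n, coeff n (A ^ k) = (∑' n, coeff n A) ^ k := by
  induction k with
  | zero => simp [coeff_one]
  | succ k ih =>
    simp_rw [pow_succ, ← ih, coeff_mul]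
    exact (tsum_mul_tsum_eq_tsum_sum_antidiagonal_of_summable_norm
      (summable_norm_coeff_pow hA k) hA).symm

theorem hasSum_coeff_subst [NormOneClass R] [CompleteSpace R] (h0 : constantCoeff A = 0)
    (hA : Summable fun n ↦ ‖coeff n A‖)
    (hF : Summable fun k ↦ ‖coeff k F‖ * (∑' n, ‖coeff n A‖) ^ k) :
    HasSum (fun n ↦ coeff n (F.subst A)) (∑' k, coeff k F * (∑' n, coeff n A) ^ k) := by
  have hsubst : HasSubst A := .of_constantCoeff_zero' h0
  have hterm (k : ℕ) : Summable fun n ↦ ‖coeff k F * coeff n (A ^ k)‖ :=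
    .of_nonneg_of_le (fun _ ↦ norm_nonneg _) (fun _ ↦ norm_mul_le _ _)
      ((summable_norm_coeff_pow hA k).mul_left ‖coeff k F‖)
  have hdouble : Summable fun kn : ℕ × ℕ ↦ coeff kn.1 F * coeff kn.2 (A ^ kn.1) := by
    refine Summable.of_norm ((summable_prod_of_nonneg fun _ ↦ norm_nonneg _).2 ⟨fun k ↦ ?_, ?_⟩)
    · exact hterm k
    · refine .of_nonneg_of_le (fun _ ↦ tsum_nonneg fun _ ↦ norm_nonneg _) (fun k ↦ ?_) hF
      calc ∑' n, ‖coeff k F * coeff n (A ^ k)‖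
          ≤ ∑' n, ‖coeff k F‖ * ‖coeff n (A ^ k)‖ :=
            (hterm k).tsum_le_tsum (fun n ↦ norm_mul_le _ _)
              ((summable_norm_coeff_pow hA k).mul_left _)
        _ = ‖coeff k F‖ * ∑' n, ‖coeff n (A ^ k)‖ := tsum_mul_left
        _ ≤ ‖coeff k F‖ * (∑' n, ‖coeff n A‖) ^ k := by
            gcongr
            exact tsum_norm_coeff_pow_le hA k
  have hcoeff (n : ℕ) : coeff n (F.subst A) = ∑' k, coeff k F * coeff n (A ^ k) := by
    rw [coeff_subst' hsubst]
    exact (tsum_eq_finsum (coeff_subst_finite' hsubst F n)).symm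
  have hvalue : ∑' k, coeff k F * (∑' n, coeff n A) ^ k
      = ∑' n, ∑' k, coeff k F * coeff n (A ^ k) := by
    simp_rw [← tsum_coeff_pow hA, ← (summable_norm_coeff_pow hA _).of_norm.tsum_mul_left]
    exact (Summable.tsum_comm (f := fun k n ↦ coeff k F * coeff n (A ^ k)) hdouble).symm
  simp_rw [hcoeff, hvalue]
  exact hdouble.prod_symm.prod.hasSum

theorem hasSum_coeff_exp_subst {A : ℂ⟦X⟧} (h0 : constantCoeff A = 0)
    (hA : Summable fun n ↦ ‖coeff n A‖) :
    HasSum (fun n ↦ coeff n ((exp ℂ).subst A)) (Complex.exp (∑' n, coeff n A)) := by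
  have hcoeff (k : ℕ) : coeff k (exp ℂ) = (k ! : ℂ)⁻¹ := by simp [coeff_exp]
  have hF : Summable fun k ↦ ‖coeff k (exp ℂ)‖ * (∑' n, ‖coeff n A‖) ^ k := by
    simpa [hcoeff, div_eq_inv_mul] using Real.summable_pow_div_factorial (∑' n, ‖coeff n A‖)
  have hvalue : ∑' k, coeff k (exp ℂ) * (∑' n, coeff n A) ^ k
      = Complex.exp (∑' n, coeff n A) := by
    rw [Complex.exp_eq_exp_ℂ, NormedSpace.exp_eq_tsum_div]
    simp_rw [hcoeff, div_eq_inv_mul]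
  exact hvalue ▸ hasSum_coeff_subst h0 hA hF

end CoeffSum

theorem tendsto_symmCycleIndex {z : ℕ → ℂ} (hz : Summable fun m : ℕ ↦ ‖z m - 1‖ / m) :
    Tendsto (symmCycleIndex z) atTop (nhds (Complex.exp (∑' m : ℕ, (z m - 1) / m))) := by
  have hsummable : Summable fun m ↦ ‖coeff m (cycleExponent (z - 1))‖ := by
    simpa [cycleExponent] using hz
  have hsum := hasSum_coeff_exp_subst (constantCoeff_cycleExponent (z - 1)) hsummable
  rw [← symmCycleIndexSeries_eq_exp_subst] at hsum
  have hlim := hsum.tendsto_sum_nat.comp (tendsto_add_atTop_nat 1)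
  simp only [symmCycleIndexSeries, cycleExponent, coeff_mk, Function.comp_def,
    ← symmCycleIndex_one_add] at hlim
  simpa using hlim

open BoundedContinuousFunction (innerProbChar innerProbChar_apply)

section InnerProbChar

variable {E : Type*} [NormedAddCommGroup E] [InnerProductSpace ℝ E]

theorem innerProbChar_multiset_sum (t : E) (s : Multiset E) :
    innerProbChar t s.sum = (s.map (innerProbChar t)).prod := by
  induction s using Multiset.induction_on with
  | empty => simp [innerProbChar_apply]
  | cons a s ih =>
    rw [Multiset.sum_cons, Multiset.map_cons, Multiset.prod_cons, ← ih]
    simp only [innerProbChar_apply, inner_add_left, Complex.ofReal_add, add_mul, Complex.exp_add]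

theorem norm_innerProbChar_sub_one_le (t a : E) : ‖innerProbChar t a - 1‖ ≤ ‖a‖ * ‖t‖ := by
  rw [innerProbChar_apply, mul_comm _ Complex.I]
  exact Real.norm_exp_I_mul_ofReal_sub_one_le.trans (norm_inner_le_norm a t)

end InnerProbChar

section CycleSum

variable {E : Type*}

/-- The additive functional on the permutations of `n` points which gives the weight `w m` to each
cycle of length `m`, fixed points included. -/
def cycleSum [AddCommMonoid E] (w : ℕ → E) (n : ℕ) (σ : Equiv.Perm (Fin n)) : E :=
  (σ.partition.parts.map w).sum

theorem cycleSum_eq_sum_cycleCount [AddCommMonoid E] (w : ℕ → E) (n : ℕ)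
    (σ : Equiv.Perm (Fin n)) :
    cycleSum w n σ = ∑ m ∈ Finset.Icc 1 n, cycleCount m σ • w m := by
  have hsub : σ.partition.parts.toFinset ⊆ Finset.Icc 1 n := by
    simpa only [Fintype.card_fin] using toFinset_parts_subset_Icc σ.partition
  rw [cycleSum, Finset.sum_multiset_map_count]
  refine Finset.sum_subset hsub fun m _ hm ↦ ?_
  rw [Multiset.count_eq_zero_of_notMem (mt Multiset.mem_toFinset.2 hm), zero_smul]

theorem integral_uniformPerm [NormedAddCommGroup E] [NormedSpace ℝ E] [CompleteSpace E] (n : ℕ)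
    (f : Equiv.Perm (Fin n) → E) :
    ∫ σ, f σ ∂(uniformPerm n) = (n ! : ℝ)⁻¹ • ∑ σ, f σ := by
  rw [uniformPerm, PMF.integral_eq_sum]
  simp only [PMF.uniformOfFintype_apply, Fintype.card_perm, Fintype.card_fin, ENNReal.toReal_inv,
    ENNReal.toReal_natCast, ← Finset.smul_sum]

variable [NormedAddCommGroup E] [InnerProductSpace ℝ E] [MeasurableSpace E]
  [OpensMeasurableSpace E]

theorem charFun_map_cycleSum (w : ℕ → E) (n : ℕ) (t : E) :
    charFun ((uniformPerm n).map (cycleSum w n)) t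
      = symmCycleIndex (fun m ↦ innerProbChar t (w m)) n := by
  rw [charFun_eq_integral_innerProbChar, integral_map measurable_from_top.aemeasurable
    (innerProbChar t).continuous.aestronglyMeasurable, integral_uniformPerm, symmCycleIndex,
    Complex.real_smul, Complex.ofReal_inv, Complex.ofReal_natCast, inv_mul_eq_div]
  simp_rw [cycleSum, innerProbChar_multiset_sum, Multiset.map_map, Function.comp_def]

theorem tendsto_charFun_map_cycleSum {w : ℕ → E} (hw : Summable fun m : ℕ ↦ ‖w m‖ / m) (t : E) :
    Tendsto (fun n ↦ charFun ((uniformPerm n).map (cycleSum w n)) t) atTop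
      (nhds (Complex.exp (∑' m : ℕ, (innerProbChar t (w m) - 1) / m))) := by
  simp_rw [charFun_map_cycleSum]
  refine tendsto_symmCycleIndex (.of_nonneg_of_le (fun m ↦ by positivity) (fun m ↦ ?_)
    (hw.mul_right ‖t‖))
  rw [div_mul_eq_mul_div]
  gcongr
  exact norm_innerProbChar_sub_one_le t (w m)

end CycleSum

open scoped ENNReal in
theorem lintegral_natCast_poissonMeasure (r : ℝ≥0) :
    ∫⁻ k, (k : ℝ≥0∞) ∂(poissonMeasure r) = r := by
  have hshift (k : ℕ) : ENNReal.ofReal (Real.exp (-r) * r ^ (k + 1) / (k + 1)!)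
      * ((k + 1 : ℕ) : ℝ≥0∞) = r * ENNReal.ofReal (Real.exp (-r) * r ^ k / k !) := by
    rw [← ENNReal.ofReal_natCast, ← ENNReal.ofReal_coe_nnreal,
      ← ENNReal.ofReal_mul (by positivity), ← ENNReal.ofReal_mul (by positivity),
      Nat.factorial_succ]
    push_cast
    congr 1
    field_simp
    ring
  have hone := hasSum_one_poissonMeasure r
  rw [poissonMeasure, lintegral_sum_measure]
  simp only [lintegral_smul_measure, lintegral_dirac, smul_eq_mul]
  rw [tsum_eq_zero_add' ENNReal.summable]
  simp only [hshift, ENNReal.tsum_mul_left, Nat.cast_zero, mul_zero, zero_add]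
  rw [← ENNReal.ofReal_tsum_of_nonneg (fun k ↦ by positivity) hone.summable, hone.tsum_eq,
    ENNReal.ofReal_one, mul_one]

theorem aemeasurable_nat_smul {Ω E : Type*} [MeasurableSpace Ω] {P : Measure Ω} [AddMonoid E]
    [MeasurableSpace E] {N : Ω → ℕ} (hN : AEMeasurable N P) (a : E) :
    AEMeasurable (fun ω ↦ N ω • a) P :=
  (measurable_from_top (f := fun k : ℕ ↦ k • a)).comp_aemeasurable hN

section CompoundPoisson

variable {Ω E : Type*} [MeasurableSpace Ω] {P : Measure Ω} [NormedAddCommGroup E]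

theorem eLpNorm_one_smul_of_hasLaw_poissonMeasure [NormedSpace ℝ E] {N : Ω → ℕ} {r : ℝ≥0}
    (hN : HasLaw N (poissonMeasure r) P) (a : E) :
    eLpNorm (fun ω ↦ N ω • a) 1 P = r * ‖a‖ₑ := by
  have henorm (ω : Ω) : ‖N ω • a‖ₑ = N ω * ‖a‖ₑ := by
    rw [← Nat.cast_smul_eq_nsmul ℝ, enorm_smul, Real.enorm_natCast]
  simp_rw [eLpNorm_one_eq_lintegral_enorm, henorm]
  rw [lintegral_mul_const' _ _ enorm_ne_top,
    hN.lintegral_comp (f := fun k : ℕ ↦ (k : ENNReal)) (by fun_prop),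
    lintegral_natCast_poissonMeasure]

theorem charFun_map_smul_of_hasLaw_poissonMeasure [InnerProductSpace ℝ E] [MeasurableSpace E]
    [OpensMeasurableSpace E] {N : Ω → ℕ} {r : ℝ≥0} (hN : HasLaw N (poissonMeasure r) P)
    (a t : E) :
    charFun (P.map fun ω ↦ N ω • a) t = Complex.exp (r * (innerProbChar t a - 1)) := by
  rw [innerProbChar_apply, ← charFun_map_cast_poissonMeasure, charFun_apply, charFun_apply,
    integral_map (aemeasurable_nat_smul hN.aemeasurable a) (by fun_prop),
    integral_map .of_discrete (by fun_prop), ← hN.map_eq,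
    integral_map hN.aemeasurable .of_discrete]
  simp_rw [← Nat.cast_smul_eq_nsmul ℝ, real_inner_smul_left, Real.inner_apply]

variable {ι : Type*} [Countable ι] {Y : ι → Ω → ℕ} {r : ι → ℝ≥0} {w : ι → E}

theorem ae_summable_norm_poisson_smul [NormedSpace ℝ E]
    (hY : ∀ i, HasLaw (Y i) (poissonMeasure (r i)) P) (hw : Summable fun i ↦ r i * ‖w i‖₊) :
    ∀ᵐ ω ∂P, Summable fun i ↦ ‖Y i ω • w i‖ := by
  refine summable_norm_of_tsum_eLpNorm_ne_top le_rfl (fun i ↦ ?_) ?_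
  · exact (AEStronglyMeasurable.of_discrete (f := fun k : ℕ ↦ k • w i)).comp_aemeasurable
      (hY i).aemeasurable
  · simp_rw [eLpNorm_one_smul_of_hasLaw_poissonMeasure (hY _)]
    exact_mod_cast ENNReal.tsum_coe_ne_top_iff_summable.2 hw

theorem tendstoInDistribution_sum_poisson_smul [IsProbabilityMeasure P] [NormedSpace ℝ E]
    [CompleteSpace E] [MeasurableSpace E] [BorelSpace E] [SecondCountableTopology E]
    (hY : ∀ i, HasLaw (Y i) (poissonMeasure (r i)) P) (hw : Summable fun i ↦ r i * ‖w i‖₊) :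
    TendstoInDistribution (fun (S : Finset ι) ω ↦ ∑ i ∈ S, Y i ω • w i) atTop
      (fun ω ↦ ∑' i, Y i ω • w i) (fun _ ↦ P) P := by
  have hmeas (S : Finset ι) : AEMeasurable (fun ω ↦ ∑ i ∈ S, Y i ω • w i) P :=
    S.aemeasurable_fun_sum fun i _ ↦ aemeasurable_nat_smul (hY i).aemeasurable (w i)
  have hlim : ∀ᵐ ω ∂P, Tendsto (fun S : Finset ι ↦ ∑ i ∈ S, Y i ω • w i) atTop
      (nhds (∑' i, Y i ω • w i)) := by
    filter_upwards [ae_summable_norm_poisson_smul hY hw] with ω hω using hω.of_norm.hasSum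
  exact tendstoInDistribution_of_ae_tendsto hmeas
    (aemeasurable_of_tendsto_metrizable_ae atTop hmeas hlim) hlim

theorem charFun_map_tsum_poisson_smul [IsProbabilityMeasure P] [InnerProductSpace ℝ E]
    [CompleteSpace E] [MeasurableSpace E] [BorelSpace E] [SecondCountableTopology E]
    (hY : ∀ i, HasLaw (Y i) (poissonMeasure (r i)) P) (hindep : iIndepFun Y P)
    (hw : Summable fun i ↦ r i * ‖w i‖₊) (t : E) :
    charFun (P.map fun ω ↦ ∑' i, Y i ω • w i) t
      = Complex.exp (∑' i, r i * (innerProbChar t (w i) - 1)) := by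
  have hind : iIndepFun (fun i ω ↦ Y i ω • w i) P :=
    hindep.comp (fun i k ↦ k • w i) fun _ ↦ measurable_from_top
  have hfin (S : Finset ι) : charFun (P.map fun ω ↦ ∑ i ∈ S, Y i ω • w i) t
      = Complex.exp (∑ i ∈ S, r i * (innerProbChar t (w i) - 1)) := by
    rw [(hind.restrict S).charFun_map_fun_finsetSum_eq_prod fun i _ ↦
        aemeasurable_nat_smul (hY i).aemeasurable (w i),
      Finset.prod_apply, Complex.exp_sum]
    simp_rw [charFun_map_smul_of_hasLaw_poissonMeasure (hY _)]
  have hsummable : Summable fun i ↦ (r i : ℂ) * (innerProbChar t (w i) - 1) := by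
    refine .of_norm_bounded ((NNReal.summable_coe.2 hw).mul_right ‖t‖) fun i ↦ ?_
    rw [norm_mul, NNReal.coe_mul, coe_nnnorm, mul_assoc, Complex.norm_real, NNReal.norm_eq]
    gcongr
    exact norm_innerProbChar_sub_one_le t (w i)
  have hlim := (ProbabilityMeasure.tendsto_iff_forall_integral_rclike_tendsto ℂ).1
    (tendstoInDistribution_sum_poisson_smul hY hw).tendsto (innerProbChar t)
  simp only [ProbabilityMeasure.coe_mk, ← charFun_eq_integral_innerProbChar, hfin] at hlim
  exact tendsto_nhds_unique hlim ((Complex.continuous_exp.tendsto _).comp hsummable.hasSum)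

end CompoundPoisson

theorem summable_pnat_inv_mul_nnnorm {E : Type*} [SeminormedAddGroup E] {w : ℕ → E}
    (hw : Summable fun m : ℕ ↦ ‖w m‖ / m) :
    Summable fun m : ℕ+ ↦ 1 / ((m : ℕ) : ℝ≥0) * ‖w m‖₊ := by
  rw [← NNReal.summable_coe]
  simpa [Function.comp_def, div_eq_inv_mul] using hw.comp_injective PNat.coe_injective

theorem tsum_div_natCast_eq_tsum_pnat {K : Type*} [DivisionRing K] [TopologicalSpace K]
    (f : ℕ → K) : ∑' m : ℕ, f m / m = ∑' m : ℕ+, f m / (m : ℕ) := by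
  refine (PNat.coe_injective.tsum_eq (f := fun m : ℕ ↦ f m / m) fun m hm ↦ ?_).symm
  have hm0 : m ≠ 0 := by
    rintro rfl
    simp at hm
  exact ⟨⟨m, Nat.pos_of_ne_zero hm0⟩, rfl⟩

theorem tendstoInDistribution_cycleSum {Ω E : Type*} [MeasurableSpace Ω] {P : Measure Ω}
    [IsProbabilityMeasure P] [NormedAddCommGroup E] [InnerProductSpace ℝ E]
    [FiniteDimensional ℝ E] [MeasurableSpace E] [BorelSpace E] {Y : ℕ+ → Ω → ℕ}
    (hY : ∀ m : ℕ+, HasLaw (Y m) (poissonMeasure (1 / ((m : ℕ) : ℝ≥0))) P)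
    (hindep : iIndepFun Y P) {w : ℕ → E} (hw : Summable fun m : ℕ ↦ ‖w m‖ / m) :
    TendstoInDistribution (cycleSum w) atTop (fun ω ↦ ∑' m : ℕ+, Y m ω • w m) uniformPerm P := by
  have := FiniteDimensional.complete ℝ E
  have := FiniteDimensional.proper_real E
  have hw' := summable_pnat_inv_mul_nnnorm hw
  refine ⟨fun n ↦ measurable_from_top.aemeasurable,
    (tendstoInDistribution_sum_poisson_smul hY hw').aemeasurable_limit,
    ProbabilityMeasure.tendsto_of_tendsto_charFun fun t ↦ ?_⟩
  have hexponent : ∑' m : ℕ, (innerProbChar t (w m) - 1) / m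
      = ∑' m : ℕ+, ((1 / (m : ℕ) : ℝ≥0) : ℂ) * (innerProbChar t (w m) - 1) := by
    rw [tsum_div_natCast_eq_tsum_pnat]
    simp [div_eq_inv_mul]
  simpa only [ProbabilityMeasure.coe_mk, charFun_map_tsum_poisson_smul hY hindep hw', hexponent]
    using tendsto_charFun_map_cycleSum hw t

theorem summable_norm_div_natCast {E : Type*} [SeminormedAddGroup E] {w : ℕ → E}
    (hw : Summable fun m ↦ ‖w m‖) : Summable fun m : ℕ ↦ ‖w m‖ / m := by
  refine .of_nonneg_of_le (fun _ ↦ by positivity) (fun m ↦ ?_) hw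
  rcases m.eq_zero_or_pos with rfl | hm
  · simp
  · exact div_le_self (norm_nonneg _) (Nat.one_le_cast.2 hm)

section UnitDisc

variable {x : ℂ}

theorem one_sub_pow_ne_zero (hx : ‖x‖ < 1) {m : ℕ} (hm : m ≠ 0) : 1 - x ^ m ≠ 0 := by
  intro h
  have hone : ‖x ^ m‖ = 1 := by rw [← sub_eq_zero.1 h, norm_one]
  rw [norm_pow] at hone
  exact (pow_lt_one₀ (norm_nonneg x) hx hm).ne hone

theorem summable_log_one_sub_pow (hx : ‖x‖ < 1) :
    Summable fun m : ℕ ↦ Complex.log (1 - x ^ m) := by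
  simpa only [sub_eq_add_neg] using
    Complex.summable_log_one_add_of_summable (summable_geometric_of_norm_lt_one hx).neg

theorem logZ_eq_cycleSum (n : ℕ) (s x : ℂ) :
    logZ n s x = cycleSum (fun m ↦ s * Complex.log (1 - x ^ m)) n := by
  funext σ
  simp only [logZ, cycleSum_eq_sum_cycleCount, nsmul_eq_mul, Finset.mul_sum, mul_left_comm]

theorem logZInf_eq_tsum (s x : ℂ) (y : ℕ+ → ℕ) :
    logZInf s x y = ∑' m : ℕ+, y m • (s * Complex.log (1 - x ^ (m : ℕ))) := by
  simp only [logZInf, nsmul_eq_mul, mul_left_comm, tsum_mul_left]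

theorem exp_comp_logZ (hx : ‖x‖ < 1) (n : ℕ) (s : ℂ) :
    Complex.exp ∘ logZ n s x = charZ n s x := by
  funext σ
  simp only [Function.comp, logZ, charZ, Finset.mul_sum, Complex.exp_sum]
  refine Finset.prod_congr rfl fun m hm ↦ ?_
  have hm0 : m ≠ 0 := Nat.one_le_iff_ne_zero.1 (Finset.mem_Icc.1 hm).1
  rw [Complex.cpow_def_of_ne_zero (one_sub_pow_ne_zero hx hm0)]
  ring_nf

theorem hasProd_charZInf (hx : ‖x‖ < 1) (s : ℂ) {y : ℕ+ → ℕ}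
    (hy : Summable fun m : ℕ+ ↦ (y m : ℂ) * Complex.log (1 - x ^ (m : ℕ))) :
    HasProd (fun m : ℕ+ ↦ (1 - x ^ (m : ℕ)) ^ (s * (y m : ℂ))) (Complex.exp (logZInf s x y)) := by
  have hfactor (m : ℕ+) : (1 - x ^ (m : ℕ)) ^ (s * (y m : ℂ))
      = Complex.exp (s * ((y m : ℂ) * Complex.log (1 - x ^ (m : ℕ)))) := by
    rw [Complex.cpow_def_of_ne_zero (one_sub_pow_ne_zero hx m.ne_zero)]
    ring_nf
  simp_rw [hfactor]
  exact (hy.hasSum.mul_left s).cexp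

end UnitDisc

theorem mainTheorem5 {Ω : Type*} [MeasurableSpace Ω] (P : Measure Ω) [IsProbabilityMeasure P]
    (Y : ℕ+ → Ω → ℕ)
    (hY : ∀ m : ℕ+, HasLaw (Y m) (poissonMeasure (1 / ((m : ℕ) : ℝ≥0))) P)
    (hindep : iIndepFun Y P)
    (x s : ℂ) (hx : ‖x‖ < 1) :
    (∀ᵐ ω ∂P, Summable fun m : ℕ+ ↦ (Y m ω : ℂ) * Complex.log (1 - x ^ (m : ℕ))) ∧
    (∀ᵐ ω ∂P, Multipliable fun m : ℕ+ ↦ (1 - x ^ (m : ℕ)) ^ (s * (Y m ω : ℂ))) ∧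
    TendstoInDistribution (fun n : ℕ ↦ logZ n s x) atTop
      (fun ω ↦ logZInf s x (fun m ↦ Y m ω)) uniformPerm P ∧
    TendstoInDistribution (fun n : ℕ ↦ charZ n s x) atTop
      (fun ω ↦ charZInf s x (fun m ↦ Y m ω)) uniformPerm P := by
  have hsum : ∀ᵐ ω ∂P, Summable fun m : ℕ+ ↦ (Y m ω : ℂ) * Complex.log (1 - x ^ (m : ℕ)) := by
    have hw := summable_pnat_inv_mul_nnnorm (w := fun m ↦ Complex.log (1 - x ^ m))
      (summable_norm_div_natCast (summable_log_one_sub_pow hx).norm)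
    filter_upwards [ae_summable_norm_poisson_smul hY hw] with ω hω
    simpa only [nsmul_eq_mul] using hω.of_norm
  have hlog : TendstoInDistribution (fun n : ℕ ↦ logZ n s x) atTop
      (fun ω ↦ logZInf s x (fun m ↦ Y m ω)) uniformPerm P := by
    simp_rw [logZ_eq_cycleSum, logZInf_eq_tsum]
    exact tendstoInDistribution_cycleSum hY hindep
      (summable_norm_div_natCast ((summable_log_one_sub_pow hx).mul_left s).norm)
  refine ⟨hsum, ?_, hlog, ?_⟩
  · filter_upwards [hsum] with ω hω using (hasProd_charZInf hx s hω).multipliable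
  · refine (hlog.continuous_comp Complex.continuous_exp).congr
      (fun n ↦ .of_eq (exp_comp_logZ hx n s)) ?_
    filter_upwards [hsum] with ω hω using (hasProd_charZInf hx s hω).tprod_eq.symm
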